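/- For each $\varepsilon>0$ let $H_\varepsilon$ be a nonnegative self-adjoint (in general unbounded) operator in a complex Hilbert space $\mathcal H_\varepsilon$ with norm $\|\cdot\|$. Let $h_\varepsilon$ be the associated closed quadratic form, $\mathcal H^1_\varepsilon=\operatorname{dom}h_\varepsilon\subset\mathcal H_\varepsilon$ its form domain, which is a Hilbert space with the norm $\|u\|_1=(h_\varepsilon(u)+\|u\|^2)^{1/2}$, let $\mathcal H^{-1}_\varepsilon$ be the dual of $\mathcal H^1_\varepsilon$ (bounded conjugate-linear functionals) with the dual norm $\|\cdot\|_{-1}$, and extend $H_\varepsilon$ to a map $\mathcal H^1_\varepsilon\to\mathcal H^{-1}_\varepsilon$ by $(H_\varepsilon u)(v)=h_\varepsilon(v,u)$, where $h_\varepsilon(\cdot,\cdot)$ is the sesquilinear form, conjugate linear in the first argument; a vector $w\in\mathcal H_\varepsilon$ is regarded as the element $v\mapsto\langle v,w\rangle$ of $\mathcal H^{-1}_\varepsilon$. Suppose that there are vectors $u_\varepsilon\in\mathcal H^1_\varepsilon$ ($\varepsilon>0$) and constants $\lambda\ge 0$, $c>0$ such that $\|u_\varepsilon\|\ge c$ for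 all $\varepsilon>0$ and $$\|(H_\varepsilon-\lambda)u_\varepsilon\|_{-1}\to 0\quad\text{as }\varepsilon\to 0.$$ Then there are real numbers $\delta(\varepsilon)$, $\varepsilon>0$, with $\delta(\varepsilon)\to 0$ as $\varepsilon\to 0$ and $$\lambda+\delta(\varepsilon)\in\operatorname{spec}H_\varepsilon\quad\text{for all }\varepsilon>0.$$ -/

import Mathlib

open Filter Topology

/-- A nonnegative self-adjoint, in general unbounded, operator in a complex Hilbert space `E`:
a partially defined linear operator that equals its Hilbert space adjoint (in particular it is
densely defined) and satisfies `⟪x, A x⟫ ≥ 0` on its domain. -/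
structure NonnegSelfAdjoint (E : Type*) [NormedAddCommGroup E] [InnerProductSpace ℂ E]
    [CompleteSpace E] where
  op : E →ₗ.[ℂ] E
  selfAdjoint : IsSelfAdjoint op
  nonneg : ∀ x : op.domain, 0 ≤ (inner ℂ (x : E) (op x)).re

namespace NonnegSelfAdjoint

variable {E : Type*} [NormedAddCommGroup E] [InnerProductSpace ℂ E] [CompleteSpace E]

/-- The resolvent set: `z` such that `A - z : dom A → E` is bijective with bounded inverse `R`. -/
def resolventSet (A : NonnegSelfAdjoint E) : Set ℂ :=
  {z | ∃ R : E →L[ℂ] E,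
    (∀ y : E, ∃ x : A.op.domain, (x : E) = R y ∧ A.op x - z • (x : E) = y) ∧
    (∀ x : A.op.domain, R (A.op x - z • (x : E)) = x)}

/-- The spectrum of the unbounded operator `A`. -/
def spectrum (A : NonnegSelfAdjoint E) : Set ℂ := (A.resolventSet)ᶜ

theorem symm (A : NonnegSelfAdjoint E) (x y : A.op.domain) :
    inner ℂ (A.op x) (y : E) = inner ℂ (x : E) (A.op y) := by
  have h := LinearPMap.adjoint_isFormalAdjoint A.selfAdjoint.dense_domain
  rw [LinearPMap.isSelfAdjoint_def.mp A.selfAdjoint] at h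
  exact h x y

/-- The operator domain `dom A`, as a type of its own: it is given the form inner product below,
not the one inherited from `E`. -/
def OpDomain (A : NonnegSelfAdjoint E) : Type _ := A.op.domain

noncomputable instance (A : NonnegSelfAdjoint E) : AddCommGroup A.OpDomain :=
  inferInstanceAs (AddCommGroup A.op.domain)

noncomputable instance (A : NonnegSelfAdjoint E) : Module ℂ A.OpDomain :=
  inferInstanceAs (Module ℂ A.op.domain)

/-- The inclusion `dom A → E`. -/
def domIncl (A : NonnegSelfAdjoint E) : A.OpDomain →ₗ[ℂ] E := A.op.domain.subtype

/-- The operator `A` on its domain. -/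
def domOp (A : NonnegSelfAdjoint E) : A.OpDomain →ₗ[ℂ] E := A.op.toFun

/-- The form inner product `⟪x, y⟫₁ = ⟪x, A y⟫ + ⟪x, y⟫` on the operator domain. -/
@[reducible]
noncomputable def formCore (A : NonnegSelfAdjoint E) : InnerProductSpace.Core ℂ A.OpDomain where
  inner x y := inner ℂ (A.domIncl x) (A.domOp y) + inner ℂ (A.domIncl x) (A.domIncl y)
  conj_inner_symm x y := by
    have h : inner ℂ (A.domOp x) (A.domIncl y) = inner ℂ (A.domIncl x) (A.domOp y) := A.symm x y
    simp only [map_add, inner_conj_symm, h]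
  re_inner_nonneg x := by
    have h : 0 ≤ (inner ℂ (A.domIncl x) (A.domOp x)).re := A.nonneg x
    have h2 : 0 ≤ RCLike.re (inner ℂ (A.domIncl x) (A.domIncl x)) := inner_self_nonneg
    rw [map_add]
    exact add_nonneg h h2
  add_left x y z := by simp only [map_add, inner_add_left]; ring
  smul_left x y r := by simp only [map_smul, inner_smul_left]; ring
  definite x hx := by
    have h : 0 ≤ (inner ℂ (A.domIncl x) (A.domOp x)).re := A.nonneg x
    have h2 : 0 ≤ (inner ℂ (A.domIncl x) (A.domIncl x)).re := inner_self_nonneg (𝕜 := ℂ)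
    have h3 := congrArg Complex.re hx
    rw [Complex.add_re, Complex.zero_re] at h3
    have h4 : RCLike.re (inner ℂ (A.domIncl x) (A.domIncl x)) = 0 := by
      change (inner ℂ (A.domIncl x) (A.domIncl x)).re = 0
      linarith
    have h5 : A.domIncl x = 0 := by
      rw [← norm_sq_eq_re_inner] at h4
      exact norm_eq_zero.mp (pow_eq_zero_iff two_ne_zero |>.mp h4)
    exact Subtype.ext h5

noncomputable instance (A : NonnegSelfAdjoint E) : NormedAddCommGroup A.OpDomain :=
  A.formCore.toNormedAddCommGroup

noncomputable instance (A : NonnegSelfAdjoint E) : InnerProductSpace ℂ A.OpDomain :=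
  InnerProductSpace.ofCore A.formCore.toCore

theorem domInner (A : NonnegSelfAdjoint E) (x y : A.OpDomain) :
    inner ℂ x y = inner ℂ (A.domIncl x) (A.domOp y) + inner ℂ (A.domIncl x) (A.domIncl y) := rfl

theorem norm_domIncl_le (A : NonnegSelfAdjoint E) (x : A.OpDomain) : ‖A.domIncl x‖ ≤ 1 * ‖x‖ := by
  have h : 0 ≤ (inner ℂ (A.domIncl x) (A.domOp x)).re := A.nonneg x
  have h1 := norm_sq_eq_re_inner (𝕜 := ℂ) x
  have h2 := norm_sq_eq_re_inner (𝕜 := ℂ) (A.domIncl x)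
  rw [domInner, map_add] at h1
  change _ = (inner ℂ (A.domIncl x) (A.domOp x)).re + _ at h1
  rw [one_mul]
  exact le_of_sq_le_sq (by linarith) (norm_nonneg _)

/-- The form domain `E¹ = dom h` of the closed quadratic form `h` associated with `A`, with its
Hilbert space norm `‖u‖₁ = (h(u) + ‖u‖²)^(1/2)`: the completion of `dom A` in that norm. It is
identified with a subspace of `E` by the injective map `incl` below. -/
abbrev FormDomain (A : NonnegSelfAdjoint E) : Type _ := UniformSpace.Completion A.OpDomain

/-- The inclusion `dom h → E`, the continuous extension of `dom A → E`. -/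
noncomputable def incl (A : NonnegSelfAdjoint E) : A.FormDomain →L[ℂ] E :=
  (A.domIncl.mkContinuous 1 A.norm_domIncl_le).extend
    (UniformSpace.Completion.toComplL (𝕜 := ℂ) (E := A.OpDomain))

theorem incl_coe (A : NonnegSelfAdjoint E) (x : A.OpDomain) :
    A.incl (x : A.FormDomain) = A.domIncl x :=
  ContinuousLinearMap.extend_eq (A.domIncl.mkContinuous 1 A.norm_domIncl_le)
    (e := UniformSpace.Completion.toComplL (𝕜 := ℂ) (E := A.OpDomain))
    UniformSpace.Completion.denseRange_coe
    (UniformSpace.Completion.isUniformInducing_coe _) x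

/-- The sesquilinear form `h(u, v)` of `A` on its form domain (conjugate linear in `u`). -/
noncomputable def form (A : NonnegSelfAdjoint E) (u v : A.FormDomain) : ℂ :=
  inner ℂ u v - inner ℂ (A.incl u) (A.incl v)

/-- On the operator domain, `h(x, y) = ⟪x, A y⟫`. -/
theorem form_coe (A : NonnegSelfAdjoint E) (x y : A.OpDomain) :
    A.form x y = inner ℂ (A.domIncl x) (A.domOp y) := by
  rw [form, incl_coe, incl_coe, UniformSpace.Completion.inner_coe, domInner, add_sub_cancel_right]

/-- `‖u‖₁² = h(u) + ‖u‖²`. -/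
theorem norm_sq_eq (A : NonnegSelfAdjoint E) (u : A.FormDomain) :
    ‖u‖ ^ 2 = (A.form u u).re + ‖A.incl u‖ ^ 2 := by
  rw [norm_sq_eq_re_inner (𝕜 := ℂ) u, norm_sq_eq_re_inner (𝕜 := ℂ) (A.incl u), form,
    Complex.sub_re]
  exact (sub_add_cancel _ _).symm

/-- `h(u, y) = ⟪u, A y⟫` for `u` in the form domain and `y` in the operator domain. -/
theorem form_coe_right (A : NonnegSelfAdjoint E) (u : A.FormDomain) (y : A.OpDomain) :
    A.form u y = inner ℂ (A.incl u) (A.domOp y) := by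
  induction u using UniformSpace.Completion.induction_on with
  | hp =>
    unfold form
    exact isClosed_eq (by fun_prop) (by fun_prop)
  | ih x => rw [form_coe, incl_coe]

/-- The form is closable: the form domain really is a subspace of `E`. -/
theorem incl_injective (A : NonnegSelfAdjoint E) : Function.Injective A.incl := by
  rw [injective_iff_map_eq_zero]
  intro u hu
  have h : ∀ v : A.FormDomain, inner ℂ u v = 0 := by
    intro v
    induction v using UniformSpace.Completion.induction_on with
    | hp => exact isClosed_eq (by fun_prop) (by fun_prop)
    | ih y =>
      have h1 := A.form_coe_right u y
      rw [form, hu, inner_zero_left, inner_zero_left, sub_zero] at h1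
      exact h1
  exact inner_self_eq_zero.mp (h u)

/-- The dual `E⁻¹` of the form domain (bounded conjugate linear functionals, so that `E` embeds
linearly), with the dual norm `‖f‖₋₁ = sup {|f v| : ‖v‖₁ ≤ 1}`, Mathlib's operator norm. -/
abbrev FormDual (A : NonnegSelfAdjoint E) : Type _ := A.FormDomain →L⋆[ℂ] ℂ

/-- The embedding `E → E⁻¹`, `w ↦ (v ↦ ⟪v, w⟫)`. -/
noncomputable def toDual (A : NonnegSelfAdjoint E) (w : E) : A.FormDual :=
  (innerSLFlip ℂ w).comp A.incl

/-- The continuous extension `A : E¹ → E⁻¹`, `u ↦ (v ↦ h(v, u))`. -/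
noncomputable def ext (A : NonnegSelfAdjoint E) (u : A.FormDomain) : A.FormDual :=
  innerSLFlip ℂ u - A.toDual (A.incl u)

theorem toDual_apply (A : NonnegSelfAdjoint E) (w : E) (v : A.FormDomain) :
    A.toDual w v = inner ℂ (A.incl v) w := rfl

theorem ext_apply (A : NonnegSelfAdjoint E) (u v : A.FormDomain) : A.ext u v = A.form v u := rfl

/-- On the operator domain the extension is `A` itself. -/
theorem ext_coe (A : NonnegSelfAdjoint E) (x : A.OpDomain) :
    A.ext (x : A.FormDomain) = A.toDual (A.domOp x) := by
  refine ContinuousLinearMap.ext fun v => ?_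
  rw [ext_apply, toDual_apply, form_coe_right]

end NonnegSelfAdjoint

/-! Write `J` for `incl` and `G = J* J` for `gram`, a bounded self-adjoint operator on the form
domain. The Riesz representative of `(H - λ) u` is `u - (λ + 1) G u`, so a small dual norm makes `u`
an approximate eigenvector of `G` at `1 / (λ + 1)`. As `‖u‖₁ ≥ c`, bounded spectral theory gives a
nearby `τ` in the spectrum of `G`. Since `J J*` is `(H + 1)⁻¹`, a nonzero `τ` yields `1 / τ - 1` in
the spectrum of `H`, close to `λ`. -/

/-! ### Bounded self-adjoint operators -/

/-- A nonzero bounded self-adjoint operator has a real spectral value of modulus equal to its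
norm. -/
theorem IsSelfAdjoint.exists_real_mem_spectrum_abs_eq_norm {F : Type*} [NormedAddCommGroup F]
    [InnerProductSpace ℂ F] [CompleteSpace F] [Nontrivial F] {T : F →L[ℂ] F}
    (hT : IsSelfAdjoint T) : ∃ τ : ℝ, (τ : ℂ) ∈ spectrum ℂ T ∧ |τ| = ‖T‖ := by
  obtain ⟨k, hk, hk'⟩ := spectrum.exists_nnnorm_eq_spectralRadius T
  rw [hT.spectralRadius_eq_nnnorm] at hk'
  have hnorm : ‖k‖ = ‖T‖ := by
    have h : ‖k‖₊ = ‖T‖₊ := by exact_mod_cast hk'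
    exact congrArg NNReal.toReal h
  have hre : k = (k.re : ℂ) := hT.mem_spectrum_eq_re hk
  refine ⟨k.re, hre ▸ hk, ?_⟩
  rw [← hnorm]
  conv_rhs => rw [hre, Complex.norm_real, Real.norm_eq_abs]

/-- An approximate eigenvector of a bounded self-adjoint operator locates a spectral value. -/
theorem IsSelfAdjoint.exists_mem_spectrum_abs_sub_mul_norm_le {F : Type*} [NormedAddCommGroup F]
    [InnerProductSpace ℂ F] [CompleteSpace F] [Nontrivial F] {T : F →L[ℂ] F}
    (hT : IsSelfAdjoint T) (s : ℝ) (u : F) :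
    ∃ τ : ℝ, (τ : ℂ) ∈ spectrum ℂ T ∧ |τ - s| * ‖u‖ ≤ ‖T u - (s : ℂ) • u‖ := by
  by_cases hs : (s : ℂ) ∈ spectrum ℂ T
  · exact ⟨s, hs, by simp⟩
  have hunit : IsUnit (T - algebraMap ℂ (F →L[ℂ] F) s) := by
    rw [spectrum.notMem_iff, ← IsUnit.neg_iff, neg_sub] at hs
    exact hs
  obtain ⟨U, hU⟩ := hunit
  have hUsa : star U = U := by
    apply Units.ext
    rw [Units.coe_star, hU, star_sub, hT.star_eq, ← algebraMap_star_comm]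
    simp
  have hinv : IsSelfAdjoint ((U⁻¹ : (F →L[ℂ] F)ˣ) : F →L[ℂ] F) := by
    rw [IsSelfAdjoint, ← Units.coe_star, star_inv, hUsa]
  -- With `|k| = ‖(T - s)⁻¹‖`, the point `k⁻¹` of the spectrum of `T - s` satisfies `|k⁻¹| ‖u‖ ≤ ‖(T
  -- - s) u‖`.
  obtain ⟨k, hk, hknorm⟩ := hinv.exists_real_mem_spectrum_abs_eq_norm
  have hk0 : k ≠ 0 := by
    rintro rfl
    rw [Complex.ofReal_zero] at hk
    exact spectrum.zero_notMem ℂ (U⁻¹).isUnit hk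
  have hmem : ((k : ℂ))⁻¹ ∈ spectrum ℂ (U : F →L[ℂ] F) := by
    have h := (spectrum.inv_mem_iff (r := Units.mk0 (k : ℂ) (by exact_mod_cast hk0)) (a := U⁻¹)).mp hk
    simpa using h
  refine ⟨k⁻¹ + s, ?_, ?_⟩
  · rw [hU, sub_eq_neg_add, ← spectrum.add_mem_iff] at hmem
    push_cast
    exact hmem
  · have hu : u = ((U⁻¹ : (F →L[ℂ] F)ˣ) : F →L[ℂ] F) (T u - (s : ℂ) • u) := by
      have h : ((U⁻¹ : (F →L[ℂ] F)ˣ) : F →L[ℂ] F) ((U : F →L[ℂ] F) u) = u := by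
        rw [← mul_apply_eq_comp, Units.inv_mul, one_apply_eq_self]
      rw [hU] at h
      exact h.symm
    have hle := ((U⁻¹ : (F →L[ℂ] F)ˣ) : F →L[ℂ] F).le_opNorm (T u - (s : ℂ) • u)
    rw [← hu, ← hknorm] at hle
    rw [add_sub_cancel_right, abs_inv, inv_mul_le_iff₀ (abs_pos.mpr hk0)]
    exact hle

/-! ### The Gram operator and transfer of spectra -/

namespace NonnegSelfAdjoint

open ContinuousLinearMap

variable {E : Type*} [NormedAddCommGroup E] [InnerProductSpace ℂ E] [CompleteSpace E]

/-- The bounded operator on the form domain representing the inner product of `E`. -/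
noncomputable def gram (A : NonnegSelfAdjoint E) : A.FormDomain →L[ℂ] A.FormDomain :=
  (adjoint A.incl).comp A.incl

theorem inner_gram (A : NonnegSelfAdjoint E) (v u : A.FormDomain) :
    inner ℂ v (A.gram u) = inner ℂ (A.incl v) (A.incl u) := by
  rw [gram, comp_apply, adjoint_inner_right]

theorem isSelfAdjoint_gram (A : NonnegSelfAdjoint E) : IsSelfAdjoint A.gram := by
  rw [ContinuousLinearMap.isSelfAdjoint_iff', gram, adjoint_comp, adjoint_adjoint]

/-- The adjoint of the inclusion inverts `A + 1` on the operator domain. -/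
theorem adjoint_incl_add (A : NonnegSelfAdjoint E) (x : A.OpDomain) :
    adjoint A.incl (A.domOp x + A.domIncl x) = (x : A.FormDomain) := by
  refine ext_inner_left ℂ fun v => ?_
  rw [adjoint_inner_right, inner_add_right, ← form_coe_right, form, incl_coe, sub_add_cancel]

/-- The dual norm of `(A - l) u` dominates the form norm of its Riesz representative. -/
theorem norm_sub_smul_gram_le (A : NonnegSelfAdjoint E) (l : ℝ) (u : A.FormDomain) :
    ‖u - ((l : ℂ) + 1) • A.gram u‖ ≤ ‖A.ext u - (l : ℂ) • A.toDual (A.incl u)‖ := by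
  set w := u - ((l : ℂ) + 1) • A.gram u with hw
  set f := A.ext u - (l : ℂ) • A.toDual (A.incl u) with hf
  -- `w` represents `f`, so testing `f` on `w` itself gives `‖w‖² ≤ ‖f‖ ‖w‖`.
  have hfw : f w = inner ℂ w w := by
    have h : f w = A.form w u - (l : ℂ) * inner ℂ (A.incl w) (A.incl u) := rfl
    rw [h]
    have h2 : inner ℂ w w = inner ℂ w (u - ((l : ℂ) + 1) • A.gram u) := by rw [← hw]
    rw [h2, inner_sub_right, inner_smul_right, inner_gram, form]
    ring
  have hle := f.le_opNorm w
  rw [hfw, inner_self_eq_norm_sq_to_K, norm_pow, RCLike.norm_ofReal, abs_norm, pow_two] at hle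
  rcases (norm_nonneg w).eq_or_lt with h0 | h0
  · rw [← h0]; exact norm_nonneg f
  · exact le_of_mul_le_mul_right hle h0

/-- Nonzero spectral values `τ` of `gram` give spectral values `1 / τ - 1` of `A`. -/
theorem inv_sub_one_mem_spectrum (A : NonnegSelfAdjoint E) {τ : ℝ} (hτ : τ ≠ 0)
    (h : (τ : ℂ) ∈ _root_.spectrum ℂ A.gram) : ((τ⁻¹ - 1 : ℝ) : ℂ) ∈ A.spectrum := by
  rintro ⟨R, hR, -⟩
  refine h ?_
  set a : ℂ := (τ : ℂ)⁻¹ with ha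
  have hτ' : (τ : ℂ) ≠ 0 := by exact_mod_cast hτ
  -- Here `R = (A + 1 - a)⁻¹`, so `y + a R y = (A + 1) R y`, and `J J*` undoes `A + 1`.
  have key : ∀ y : E, A.incl (adjoint A.incl (y + a • R y)) = R y := by
    intro y
    obtain ⟨x, hx, hxy⟩ := hR y
    have h1 : A.incl (adjoint A.incl (A.op x + (x : E))) = (x : E) :=
      (congrArg A.incl (A.adjoint_incl_add x)).trans (A.incl_coe x)
    have h2 : y + a • R y = A.op x + (x : E) := by
      rw [← hx, ← hxy, ha]
      push_cast
      module
    rw [h2, h1, hx]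
  -- This is `(1 - a J* J)⁻¹ = 1 + a J* (1 - a J J*)⁻¹ J`, where `(1 - a J J*)⁻¹ = 1 + a R`.
  have hright : (1 - a • A.gram) *
      (1 + a • ((adjoint A.incl).comp ((1 + a • R : E →L[ℂ] E).comp A.incl))) = 1 := by
    refine ContinuousLinearMap.ext fun v => ?_
    have hgram : ∀ w, A.gram w = adjoint A.incl (A.incl w) := fun _ => rfl
    change (v + a • adjoint A.incl (A.incl v + a • R (A.incl v)))
      - a • A.gram (v + a • adjoint A.incl (A.incl v + a • R (A.incl v))) = v
    rw [hgram, map_add A.incl, map_smul A.incl, key, add_sub_cancel_right]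
  -- As `a` is real, the adjoint of the right inverse is a left inverse.
  have hsa : star (1 - a • A.gram) = 1 - a • A.gram := by
    rw [star_sub, star_one, star_smul, A.isSelfAdjoint_gram.star_eq, ha]
    simp
  have hleft := congrArg star hright
  rw [star_mul, hsa, star_one] at hleft
  have hunit : IsUnit (1 - a • A.gram) :=
    isUnit_iff_exists_and_exists.mpr ⟨⟨_, hright⟩, ⟨_, hleft⟩⟩
  have heq : algebraMap ℂ (A.FormDomain →L[ℂ] A.FormDomain) τ - A.gram
      = Units.mk0 (τ : ℂ) hτ' • (1 - a • A.gram) := by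
    rw [Units.smul_mk0, smul_sub, smul_smul, ha, mul_inv_cancel₀ hτ', one_smul,
      Algebra.algebraMap_eq_smul_one]
  change IsUnit _
  rw [heq]
  exact hunit.smul _

/-- Covers those `ε` whose residual is not small. Since `⟪u, G u⟫ = ‖J u‖² ≠ 0`, `G` is nonzero and
has a spectral value of modulus `‖G‖ ≠ 0`. -/
theorem exists_mem_spectrum (A : NonnegSelfAdjoint E) {u : A.FormDomain} (hu : A.incl u ≠ 0) :
    ∃ μ : ℝ, (μ : ℂ) ∈ A.spectrum := by
  have hu0 : u ≠ 0 := by rintro rfl; exact hu (map_zero _)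
  have : Nontrivial A.FormDomain := ⟨u, 0, hu0⟩
  obtain ⟨τ, hτ, hnorm⟩ := A.isSelfAdjoint_gram.exists_real_mem_spectrum_abs_eq_norm
  refine ⟨_, A.inv_sub_one_mem_spectrum ?_ hτ⟩
  rintro rfl
  have hg : A.gram = 0 := norm_eq_zero.mp (by rw [← hnorm, abs_zero])
  have h := A.inner_gram u u
  rw [hg, zero_apply, inner_zero_right] at h
  exact hu (inner_self_eq_zero.mp h.symm)

theorem norm_incl_le (A : NonnegSelfAdjoint E) (u : A.FormDomain) : ‖A.incl u‖ ≤ ‖u‖ := by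
  induction u using UniformSpace.Completion.induction_on with
  | hp => exact isClosed_le (by fun_prop) (by fun_prop)
  | ih x =>
    rw [incl_coe, UniformSpace.Completion.norm_coe]
    simpa using A.norm_domIncl_le x

/-- Quantitative location of the spectrum near an approximate eigenvalue in the weak sense. -/
theorem exists_mem_spectrum_abs_sub_le (A : NonnegSelfAdjoint E) {u : A.FormDomain} {l c : ℝ}
    (hl : 0 ≤ l) (hc : 0 < c) (hu : c ≤ ‖A.incl u‖)
    (hsmall : ‖A.ext u - (l : ℂ) • A.toDual (A.incl u)‖ ≤ c / 2) :
    ∃ μ : ℝ, (μ : ℂ) ∈ A.spectrum ∧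
      |μ - l| ≤ 2 * (l + 1) / c * ‖A.ext u - (l : ℂ) • A.toDual (A.incl u)‖ := by
  set η := ‖A.ext u - (l : ℂ) • A.toDual (A.incl u)‖
  have hcu : c ≤ ‖u‖ := hu.trans (A.norm_incl_le u)
  have hu0 : u ≠ 0 := norm_pos_iff.mp (hc.trans_le hcu)
  have : Nontrivial A.FormDomain := ⟨u, 0, hu0⟩
  have hl1 : 0 < l + 1 := by linarith
  obtain ⟨τ, hτ, hle⟩ :=
    A.isSelfAdjoint_gram.exists_mem_spectrum_abs_sub_mul_norm_le (l + 1)⁻¹ u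
  have hw : ‖A.gram u - (((l + 1)⁻¹ : ℝ) : ℂ) • u‖ ≤ (l + 1)⁻¹ * η := by
    have hl1' : (l : ℂ) + 1 ≠ 0 := by exact_mod_cast hl1.ne'
    have heq : A.gram u - (((l + 1)⁻¹ : ℝ) : ℂ) • u
        = -((((l + 1)⁻¹ : ℝ) : ℂ) • (u - ((l : ℂ) + 1) • A.gram u)) := by
      rw [smul_sub, smul_smul]
      push_cast
      rw [inv_mul_cancel₀ hl1', one_smul, neg_sub]
    rw [heq, norm_neg, norm_smul, Complex.norm_real, Real.norm_eq_abs,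
      abs_of_pos (inv_pos.mpr hl1)]
    exact mul_le_mul_of_nonneg_left (A.norm_sub_smul_gram_le l u) (inv_pos.mpr hl1).le
  have h1 : |τ - (l + 1)⁻¹| * c ≤ (l + 1)⁻¹ * η :=
    ((mul_le_mul_of_nonneg_left hcu (abs_nonneg _)).trans hle).trans hw
  have h2 : |(l + 1) * τ - 1| * c ≤ η := by
    have h3 := mul_le_mul_of_nonneg_left h1 hl1.le
    rw [← mul_assoc, ← mul_assoc, mul_inv_cancel₀ hl1.ne', one_mul] at h3
    have h4 : (l + 1) * τ - 1 = (l + 1) * (τ - (l + 1)⁻¹) := by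
      rw [mul_sub, mul_inv_cancel₀ hl1.ne']
    rwa [h4, abs_mul, abs_of_pos hl1]
  -- The threshold `c / 2` keeps `τ ≥ 1 / (2 (l + 1))`, away from the point `0` where `τ⁻¹ - 1`
  -- blows up; hence the factor `2 (l + 1)`.
  have h3 : |(l + 1) * τ - 1| ≤ 1 / 2 := by
    refine le_of_mul_le_mul_right ?_ hc
    linarith
  have h4 : 1 / 2 ≤ (l + 1) * τ := by linarith [(abs_le.mp h3).1]
  have hτpos : 0 < τ := pos_of_mul_pos_right (by linarith) hl1.le
  refine ⟨τ⁻¹ - 1, A.inv_sub_one_mem_spectrum hτpos.ne' hτ, ?_⟩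
  have h5 : |τ⁻¹ - 1 - l| = |(l + 1) * τ - 1| * τ⁻¹ := by
    rw [← abs_of_pos (inv_pos.mpr hτpos), ← abs_mul, abs_of_pos (inv_pos.mpr hτpos), ← abs_neg]
    congr 1
    field_simp
    ring
  have h6 : τ⁻¹ ≤ 2 * (l + 1) := by
    rw [inv_le_iff_one_le_mul₀ hτpos]
    linarith
  have h7 : |(l + 1) * τ - 1| ≤ η / c := (le_div_iff₀ hc).mpr h2
  calc |τ⁻¹ - 1 - l| = |(l + 1) * τ - 1| * τ⁻¹ := h5
    _ ≤ η / c * (2 * (l + 1)) :=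
      mul_le_mul h7 h6 (inv_pos.mpr hτpos).le ((abs_nonneg _).trans h7)
    _ = 2 * (l + 1) / c * η := by ring

end NonnegSelfAdjoint

theorem lemma3p4 {E : Set.Ioi (0 : ℝ) → Type*}
    [∀ ε, NormedAddCommGroup (E ε)] [∀ ε, InnerProductSpace ℂ (E ε)] [∀ ε, CompleteSpace (E ε)]
    (H : ∀ ε, NonnegSelfAdjoint (E ε))
    (u : ∀ ε, (H ε).FormDomain)
    (lam c : ℝ) (hlam : 0 ≤ lam) (hc : 0 < c)
    (hlim : Tendsto
      (fun ε => ‖(H ε).ext (u ε) - (lam : ℂ) • (H ε).toDual ((H ε).incl (u ε))‖)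
      (comap (Subtype.val : Set.Ioi (0 : ℝ) → ℝ) (𝓝 0)) (𝓝 0))
    (hu : ∀ ε, c ≤ ‖(H ε).incl (u ε)‖) :
    ∃ δ : Set.Ioi (0 : ℝ) → ℝ,
      Tendsto δ (comap (Subtype.val : Set.Ioi (0 : ℝ) → ℝ) (𝓝 0)) (𝓝 0) ∧
      ∀ ε, ((lam + δ ε : ℝ) : ℂ) ∈ (H ε).spectrum := by
  -- A spectral point is needed for every `ε`, but the estimate only once the residual is at most `c
  -- / 2`, which holds eventually.
  have hex : ∀ ε, ∃ μ : ℝ, (μ : ℂ) ∈ (H ε).spectrum ∧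
      (‖(H ε).ext (u ε) - (lam : ℂ) • (H ε).toDual ((H ε).incl (u ε))‖ ≤ c / 2 →
        |μ - lam| ≤ 2 * (lam + 1) / c *
          ‖(H ε).ext (u ε) - (lam : ℂ) • (H ε).toDual ((H ε).incl (u ε))‖) := by
    intro ε
    by_cases hs : ‖(H ε).ext (u ε) - (lam : ℂ) • (H ε).toDual ((H ε).incl (u ε))‖ ≤ c / 2
    · obtain ⟨μ, hμ, hle⟩ := (H ε).exists_mem_spectrum_abs_sub_le hlam hc (hu ε) hs
      exact ⟨μ, hμ, fun _ => hle⟩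
    · obtain ⟨μ, hμ⟩ :=
        (H ε).exists_mem_spectrum (norm_pos_iff.mp (hc.trans_le (hu ε)))
      exact ⟨μ, hμ, fun h => absurd h hs⟩
  choose μ hμ hle using hex
  refine ⟨fun ε => μ ε - lam, ?_, fun ε => by simpa using hμ ε⟩
  have hbound := hlim.const_mul (2 * (lam + 1) / c)
  rw [mul_zero] at hbound
  refine squeeze_zero_norm' ?_ hbound
  filter_upwards [hlim.eventually_le_const (half_pos hc)] with ε hε
  exact hle ε hε
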